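/- Let $d\ge 0$ and $m\ge 1$ be integers and let $$\mathcal{SHL}(d,m)=\{f(\mathbf x)=\mathbf a^T\max(0,W\mathbf x+\mathbf b)+c:\ \mathbf a,\mathbf b\in\mathbb R^m,\ W\in\mathbb R^{m\times d},\ c\in\mathbb R\}$$ be the set of functions $f:\mathbb R^d\to\mathbb R$ computed by a single hidden layer of $m$ rectifier units (the maximum is taken entrywise). For such an $f$ let $\mathcal B_f=\{\mathbf x: f(\mathbf x)=0\}$. We say that $\mathcal B_f$ has $n$ facets if there are $\mathbf a_k\in\mathbb R^d\setminus\{0\}$ and $b_k\in\mathbb R$ ($1\le k\le n$) such that the sets $\Omega_k=\{\mathbf x:\mathbf a_k^T\mathbf x+b_k=0,\ f(\mathbf x)=0\}$ are distinct, $\mathcal B_f=\bigcup_{k=1}^n\Omega_k$, and no $\Omega_i$ is redundant, i.e. $\bigcup_{k\ne i}\Omega_k\ne\mathcal B_f$ for every $i$. Put $$G(d,m)=\sum_{k=0}^{d}\binom mk,\qquad C(d,m)=2\sum_{k=0}^{d-1}\binom{m-1}{k}.$$ Then the maximum number of facets of $\mathcal B_f$ over all $f\in\mathcal{SHL}(d,m)$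 exists and satisfies $$C(d,m)-1\ \le\ \max_{f\in\mathcal{SHL}(d,m)}\#(\mathcal B_f)\ \le\ G(d,m),$$ where the maximum is over all pairs $(f,n)$ such that $\mathcal B_f$ has $n$ facets. The same holds if, in addition, every facet $\Omega_k$ is required to be $(d-1)$-dimensional, i.e. to contain a nonempty relatively open subset of the hyperplane $\mathbf a_k^T\mathbf x+b_k=0$. -/

import Mathlib

/-- `G(d,m) = ∑_{k=0}^{d} (m choose k)`. -/
def regionCount (d m : ℕ) : ℕ := ∑ k ∈ Finset.range (d + 1), m.choose k

/-- `C(d,m) = 2 ∑_{k=0}^{d-1} (m-1 choose k)`, for `m ≥ 1`. -/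
def unboundedRegionCount (d m : ℕ) : ℕ := 2 * ∑ k ∈ Finset.range d, (m - 1).choose k

/-- The functions `x ↦ aᵀ max(0, W x + b) + c` on `ℝ^d` (the maximum taken entrywise) that are
computed by a single hidden layer of `m` rectifier units. -/
def SHL (d m : ℕ) : Set ((Fin d → ℝ) → ℝ) :=
  {f | ∃ (a : Fin m → ℝ) (W : Matrix (Fin m) (Fin d) ℝ) (b : Fin m → ℝ) (c : ℝ),
    f = fun x => a ⬝ᵥ (fun i => max 0 ((W.mulVec x + b) i)) + c}

/-- The boundary `{x | f x = 0}` of the classifier `f`. -/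
def boundary {d : ℕ} (f : (Fin d → ℝ) → ℝ) : Set (Fin d → ℝ) := {x | f x = 0}

/-- The part `{x | aᵀ x + b = 0, f x = 0}` of the boundary of `f` on the hyperplane `aᵀ x + b = 0`. -/
def boundarySection {d : ℕ} (f : (Fin d → ℝ) → ℝ) (a : Fin d → ℝ) (b : ℝ) : Set (Fin d → ℝ) :=
  {x | a ⬝ᵥ x + b = 0 ∧ f x = 0}

/-- The hyperplanes `(a k)ᵀ x + b k = 0`, `k < n`, cut the boundary of `f` into `n` facets: the
sections are distinct, they cover the boundary, and none of them is redundant. -/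
structure IsFacetDecomposition {d : ℕ} (f : (Fin d → ℝ) → ℝ) (n : ℕ)
    (a : Fin n → Fin d → ℝ) (b : Fin n → ℝ) : Prop where
  normal_ne_zero : ∀ k, a k ≠ 0
  distinct : Function.Injective fun k => boundarySection f (a k) (b k)
  cover : boundary f = ⋃ k, boundarySection f (a k) (b k)
  irredundant : ∀ i, (⋃ k ∈ {k | k ≠ i}, boundarySection f (a k) (b k)) ≠ boundary f

/-- The boundary of `f` has `n` facets. -/
def HasFacets {d : ℕ} (f : (Fin d → ℝ) → ℝ) (n : ℕ) : Prop :=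
  ∃ (a : Fin n → Fin d → ℝ) (b : Fin n → ℝ), IsFacetDecomposition f n a b

/-- The boundary of `f` has `n` facets, each of dimension `d - 1`: the facet contains a
neighbourhood, relative to its hyperplane, of some point of that hyperplane. -/
def HasFullDimFacets {d : ℕ} (f : (Fin d → ℝ) → ℝ) (n : ℕ) : Prop :=
  ∃ (a : Fin n → Fin d → ℝ) (b : Fin n → ℝ), IsFacetDecomposition f n a b ∧
    ∀ k, ∃ x, a k ⬝ᵥ x + b k = 0 ∧ ∀ᶠ y in nhds x, a k ⬝ᵥ y + b k = 0 → f y = 0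

/-! Upper bound: on the points with a fixed set of active units `f` is affine, so its zeros there
form a convex set, and a convex set covered by finitely many hyperplanes lies in one of them
(`Convex.exists_subset_hyperplane`). One hyperplane per activation pattern thus covers the boundary,
and irredundancy leaves no others. The patterns have VC dimension at most `d`, so Sauer–Shelah
bounds their number by `regionCount d m`.

Lower bound: `∑ i, max 0 (W i ⬝ᵥ x)` is the maximum over `S` of the linear forms `rowSum W S ⬝ᵥ x`,
and each nonempty strict sign pattern `S` gives a facet of its level set at 1
(`hasFullDimFacets_conicalNetwork`). For rows on the moment curve, the patterns include the signs at
`0, …, m - 1` of polynomials of degree less than `d`. Choosing fewer than `d` of the `m - 1` gaps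
for sign changes, and a global sign, yields `unboundedRegionCount d m` patterns; only the empty one
is lost. -/

open Finset Matrix

/-! ### Counting activation patterns -/

/-- The units that are active at `x`. -/
noncomputable def activeUnits {d m : ℕ} (W : Matrix (Fin m) (Fin d) ℝ) (b : Fin m → ℝ)
    (x : Fin d → ℝ) : Finset (Fin m) :=
  {i | 0 < W i ⬝ᵥ x + b i}

/-- The sets of units that are simultaneously active at some point. -/
noncomputable def activationPatterns {d m : ℕ} (W : Matrix (Fin m) (Fin d) ℝ) (b : Fin m → ℝ) :
    Finset (Finset (Fin m)) :=
  (Set.toFinite (Set.range (activeUnits W b))).toFinset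

theorem mem_activationPatterns {d m : ℕ} {W : Matrix (Fin m) (Fin d) ℝ} {b : Fin m → ℝ}
    {S : Finset (Fin m)} : S ∈ activationPatterns W b ↔ ∃ x, activeUnits W b x = S := by
  simp [activationPatterns]

/-- More than `d` rows satisfy a relation `∑ g i • W i = 0`, so `∑ g i * (W i ⬝ᵥ x + b i)` does not
depend on `x`. Shattering realises both the sign pattern of `g` and its complement, which makes this
constant positive and nonpositive. -/
theorem card_le_of_shatters_activationPatterns {d m : ℕ} {W : Matrix (Fin m) (Fin d) ℝ}
    {b : Fin m → ℝ} {T : Finset (Fin m)} (hT : (activationPatterns W b).Shatters T) :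
    #T ≤ d := by
  by_contra! hlt
  have hdep : ¬ LinearIndepOn ℝ (fun i => W i) (T : Set (Fin m)) := by
    intro h
    have := LinearIndependent.fintype_card_le_finrank h
    simp at this
    omega
  rw [linearIndepOn_finset_iff] at hdep
  push Not at hdep
  obtain ⟨g, hg, i₀, hi₀, hne⟩ := hdep
  -- An inactive unit may have value zero, so strict positivity of the sum needs a positive
  -- coefficient.
  wlog hpos : 0 < g i₀ generalizing g
  · refine this (-g) (by simp [hg]) (by simpa using hne) ?_
    simpa using lt_of_le_of_ne (not_lt.1 hpos) hne
  have hconst : ∀ x, ∑ i ∈ T, g i * (W i ⬝ᵥ x + b i) = ∑ i ∈ T, g i * b i := by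
    intro x
    have h := congrArg (fun v => v ⬝ᵥ x) hg
    simp only [sum_dotProduct, smul_dotProduct, smul_eq_mul, zero_dotProduct] at h
    simp only [mul_add, sum_add_distrib, h, zero_add]
  obtain ⟨u, hu, hTu⟩ := hT (filter_subset (fun i => 0 < g i) T)
  obtain ⟨x, rfl⟩ := mem_activationPatterns.1 hu
  obtain ⟨u, hu, hTu'⟩ := hT (filter_subset (fun i => ¬ 0 < g i) T)
  obtain ⟨y, rfl⟩ := mem_activationPatterns.1 hu
  have hx : ∀ i ∈ T, 0 < W i ⬝ᵥ x + b i ↔ 0 < g i := by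
    intro i hi
    simpa [activeUnits, hi] using Finset.ext_iff.1 hTu i
  have hy : ∀ i ∈ T, 0 < W i ⬝ᵥ y + b i ↔ ¬ 0 < g i := by
    intro i hi
    simpa [activeUnits, hi] using Finset.ext_iff.1 hTu' i
  have h₁ : 0 < ∑ i ∈ T, g i * (W i ⬝ᵥ x + b i) := by
    refine sum_pos' (fun i hi => ?_) ⟨i₀, hi₀, mul_pos hpos ((hx i₀ hi₀).2 hpos)⟩
    by_cases h : 0 < g i
    · exact (mul_pos h ((hx i hi).2 h)).le
    · exact mul_nonneg_of_nonpos_of_nonpos (not_lt.1 h) (not_lt.1 (mt (hx i hi).1 h))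
  have h₂ : ∑ i ∈ T, g i * (W i ⬝ᵥ y + b i) ≤ 0 := by
    refine sum_nonpos fun i hi => ?_
    by_cases h : 0 < g i
    · exact mul_nonpos_of_nonneg_of_nonpos h.le (not_lt.1 fun h' => (hy i hi).1 h' h)
    · exact mul_nonpos_of_nonpos_of_nonneg (not_lt.1 h) ((hy i hi).2 h).le
  rw [hconst] at h₁ h₂
  exact h₂.not_gt h₁

theorem card_activationPatterns_le {d m : ℕ} (W : Matrix (Fin m) (Fin d) ℝ) (b : Fin m → ℝ) :
    #(activationPatterns W b) ≤ regionCount d m := by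
  refine (card_le_card_shatterer _).trans (card_shatterer_le_sum_vcDim.trans ?_)
  rw [Fintype.card_fin, regionCount]
  refine sum_le_sum_of_subset fun k hk => ?_
  have : (activationPatterns W b).vcDim ≤ d :=
    Finset.sup_le fun T hT => card_le_of_shatters_activationPatterns (mem_shatterer.1 hT)
  simp only [mem_Iic, mem_range] at hk ⊢
  omega

/-! ### The upper bound -/

/-- A convex set covered by finitely many hyperplanes lies in one of them. -/
theorem Convex.exists_subset_hyperplane {d n : ℕ} {C : Set (Fin d → ℝ)} (hC : Convex ℝ C)
    (hne : C.Nonempty) (a : Fin n → Fin d → ℝ) (b : Fin n → ℝ)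
    (hcov : ∀ x ∈ C, ∃ k, a k ⬝ᵥ x + b k = 0) : ∃ k, ∀ x ∈ C, a k ⬝ᵥ x + b k = 0 := by
  classical
  let I : (Fin d → ℝ) → Finset (Fin n) := fun x => {k | a k ⬝ᵥ x + b k = 0}
  -- Take `x` on as few hyperplanes as possible. A short move towards `y` meets no new ones, hence
  -- by minimality stays on the same ones, and these then contain `y`.
  obtain ⟨x, hx, hmin⟩ :=
    (measure fun x => #(I x)).wf.has_min C hne
  obtain ⟨k, hk⟩ := hcov x hx
  refine ⟨k, fun y hy => ?_⟩
  let z : ℝ → Fin d → ℝ := fun t => (1 - t) • x + t • y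
  have hz : ∀ j t, a j ⬝ᵥ z t + b j =
      (1 - t) * (a j ⬝ᵥ x + b j) + t * (a j ⬝ᵥ y + b j) := by
    intro j t
    simp only [z, dotProduct_add, dotProduct_smul, smul_eq_mul]
    ring
  have hev : ∀ᶠ t in nhdsWithin (0 : ℝ) (Set.Ioi 0), I (z t) ⊆ I x := by
    have : ∀ j, ∀ᶠ t in nhds (0 : ℝ), j ∈ I (z t) → j ∈ I x := by
      intro j
      by_cases hj : a j ⬝ᵥ x + b j = 0
      · exact Filter.Eventually.of_forall fun t _ => by simp [I, hj]
      · have hc : Continuous fun t : ℝ =>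
            (1 - t) * (a j ⬝ᵥ x + b j) + t * (a j ⬝ᵥ y + b j) := by fun_prop
        filter_upwards [hc.continuousAt.eventually_ne (x := (0 : ℝ)) (y := 0) (by simpa using hj)]
          with t ht h
        simp only [I, mem_filter, mem_univ, true_and, hz] at h
        exact absurd h ht
    filter_upwards [nhdsWithin_le_nhds (Filter.eventually_all.2 this)] with t ht j hj
    exact ht j hj
  obtain ⟨t, ht, ht0, ht1⟩ := (hev.and (Ioo_mem_nhdsGT one_pos)).exists
  have hzC : z t ∈ C := hC hx hy (by linarith) ht0.le (by ring)
  have hEq : I (z t) = I x := eq_of_subset_of_card_le ht (not_lt.1 (hmin _ hzC))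
  have hkz : k ∈ I (z t) := by rw [hEq]; simpa [I] using hk
  simp only [I, mem_filter, mem_univ, true_and, hz, hk, mul_zero, zero_add] at hkz
  exact (mul_eq_zero.1 hkz).resolve_left ht0.ne'

theorem dotProduct_max_eq_sum_activeUnits {d m : ℕ} (W : Matrix (Fin m) (Fin d) ℝ)
    (a b : Fin m → ℝ) (x : Fin d → ℝ) :
    a ⬝ᵥ (fun i => max 0 ((W.mulVec x + b) i)) =
      ∑ i ∈ activeUnits W b x, a i * (W i ⬝ᵥ x + b i) := by
  rw [activeUnits, sum_filter, dotProduct]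
  refine sum_congr rfl fun i _ => ?_
  change a i * max 0 (W i ⬝ᵥ x + b i) = _
  split_ifs with h
  · rw [max_eq_right h.le]
  · rw [max_eq_left (not_lt.1 h), mul_zero]

theorem convex_zeros_of_activeUnits_eq {d m : ℕ} (W : Matrix (Fin m) (Fin d) ℝ)
    (a b : Fin m → ℝ) (c : ℝ) (S : Finset (Fin m)) :
    Convex ℝ {x | activeUnits W b x = S ∧
      a ⬝ᵥ (fun i => max 0 ((W.mulVec x + b) i)) + c = 0} := by
  rintro x ⟨hxS, hx⟩ y ⟨hyS, hy⟩ s t hs ht hst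
  have hlin : ∀ i, W i ⬝ᵥ (s • x + t • y) + b i =
      s * (W i ⬝ᵥ x + b i) + t * (W i ⬝ᵥ y + b i) := by
    intro i
    simp only [dotProduct_add, dotProduct_smul, smul_eq_mul]
    linear_combination (-b i) * hst
  have hS : activeUnits W b (s • x + t • y) = S := by
    ext i
    have hxi := Finset.ext_iff.1 hxS i
    have hyi := Finset.ext_iff.1 hyS i
    simp only [activeUnits, mem_filter, mem_univ, true_and, hlin] at hxi hyi ⊢
    by_cases hi : i ∈ S
    · have h₁ := hxi.2 hi
      have h₂ := hyi.2 hi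
      refine iff_of_true ?_ hi
      rcases hs.eq_or_lt with rfl | hs
      · have : t = 1 := by linarith
        simpa [this] using h₂
      · exact add_pos_of_pos_of_nonneg (mul_pos hs h₁) (mul_nonneg ht h₂.le)
    · have h₁ := not_lt.1 (mt hxi.1 hi)
      have h₂ := not_lt.1 (mt hyi.1 hi)
      exact iff_of_false (not_lt.2 (add_nonpos (mul_nonpos_of_nonneg_of_nonpos hs h₁)
        (mul_nonpos_of_nonneg_of_nonpos ht h₂))) hi
  refine ⟨hS, ?_⟩
  rw [dotProduct_max_eq_sum_activeUnits, hS]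
  rw [dotProduct_max_eq_sum_activeUnits, hxS] at hx
  rw [dotProduct_max_eq_sum_activeUnits, hyS] at hy
  have : ∑ i ∈ S, a i * (W i ⬝ᵥ (s • x + t • y) + b i) =
      s * ∑ i ∈ S, a i * (W i ⬝ᵥ x + b i) + t * ∑ i ∈ S, a i * (W i ⬝ᵥ y + b i) := by
    rw [mul_sum, mul_sum, ← sum_add_distrib]
    exact sum_congr rfl fun i _ => by rw [hlin]; ring
  rw [this]
  linear_combination s * hx + t * hy - c * hst

theorem HasFacets.le_regionCount {d m n : ℕ} {f : (Fin d → ℝ) → ℝ} (hf : f ∈ SHL d m)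
    (h : HasFacets f n) : n ≤ regionCount d m := by
  obtain ⟨α, W, β, c, rfl⟩ := hf
  obtain ⟨a, b, hab⟩ := h
  rcases Nat.eq_zero_or_pos n with rfl | hn
  · exact Nat.zero_le _
  have hcover := Set.ext_iff.1 hab.cover
  simp only [boundary, boundarySection, Set.mem_ofPred_eq, Set.mem_iUnion] at hcover
  have hex : ∀ S : Finset (Fin m), ∃ k, ∀ x, activeUnits W β x = S →
      α ⬝ᵥ (fun i => max 0 ((W.mulVec x + β) i)) + c = 0 → a k ⬝ᵥ x + b k = 0 := by
    intro S
    by_cases hN : {x | activeUnits W β x = S ∧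
      α ⬝ᵥ (fun i => max 0 ((W.mulVec x + β) i)) + c = 0}.Nonempty
    rotate_left
    -- Arbitrary index for a pattern without zeros.
    · exact ⟨⟨0, hn⟩, fun x h₁ h₂ => absurd ⟨x, h₁, h₂⟩ hN⟩
    · obtain ⟨k, hk⟩ := (convex_zeros_of_activeUnits_eq W α β c S).exists_subset_hyperplane hN a b
        fun x hx => ((hcover x).1 hx.2).imp fun _ h => h.1
      exact ⟨k, fun x h₁ h₂ => hk x ⟨h₁, h₂⟩⟩
  choose φ hφ using hex
  have hsurj : (univ : Finset (Fin n)) ⊆ (activationPatterns W β).image φ := by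
    intro i _
    by_contra hi
    refine hab.irredundant i (Set.Subset.antisymm ?_ fun x hx => ?_)
    · exact Set.iUnion₂_subset fun k _ x hx => hx.2
    · refine Set.mem_iUnion₂.2 ⟨φ (activeUnits W β x), ?_, hφ _ x rfl hx, hx⟩
      rintro rfl
      exact hi (mem_image_of_mem _ (mem_activationPatterns.2 ⟨x, rfl⟩))
  calc n = #(univ : Finset (Fin n)) := by simp
    _ ≤ #(activationPatterns W β) := (card_le_card hsurj).trans card_image_le
    _ ≤ _ := card_activationPatterns_le W β

/-! ### The lower bound -/

/-- `S` is the set of rows of `W` that are positive at a point where no row vanishes. -/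
def IsStrictPattern {d m : ℕ} (W : Matrix (Fin m) (Fin d) ℝ) (S : Finset (Fin m)) : Prop :=
  ∃ x : Fin d → ℝ, ∀ i, (i ∈ S → 0 < W i ⬝ᵥ x) ∧ (i ∉ S → W i ⬝ᵥ x < 0)

/-- Dropping a positive term or adding a negative one lowers the sum. Hence a point inside one facet
lies on no other facet's hyperplane. -/
theorem sum_lt_sum_of_pos_of_neg {m : ℕ} {y : Fin m → ℝ} {S T : Finset (Fin m)}
    (hy : ∀ i, (i ∈ S → 0 < y i) ∧ (i ∉ S → y i < 0)) (hTS : T ≠ S) :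
    ∑ i ∈ T, y i < ∑ i ∈ S, y i := by
  obtain ⟨j, hj⟩ : ∃ j, ¬ (j ∈ T ↔ j ∈ S) := by
    by_contra! h
    exact hTS (Finset.ext h)
  have h : ∑ i, (if i ∈ T then y i else 0) < ∑ i, (if i ∈ S then y i else 0) := by
    refine sum_lt_sum (fun i _ => ?_) ⟨j, mem_univ j, ?_⟩
    · have := hy i
      split_ifs <;> grind
    · have := hy j
      split_ifs <;> grind
  simpa using h

theorem sum_max_eq_sum_of_nonneg_of_nonpos {m : ℕ} {y : Fin m → ℝ} {S : Finset (Fin m)}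
    (hy : ∀ i, (i ∈ S → 0 ≤ y i) ∧ (i ∉ S → y i ≤ 0)) :
    ∑ i, max 0 (y i) = ∑ i ∈ S, y i := by
  have h : ∑ i, max 0 (y i) = ∑ i, (if i ∈ S then y i else 0) := by
    refine sum_congr rfl fun i _ => ?_
    split_ifs with hi
    · exact max_eq_right ((hy i).1 hi)
    · exact max_eq_left ((hy i).2 hi)
  simpa using h

/-- The sum of the rows of `W` with index in `S`. -/
def rowSum {d m : ℕ} (W : Matrix (Fin m) (Fin d) ℝ) (S : Finset (Fin m)) : Fin d → ℝ :=
  ∑ i ∈ S, W i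

theorem rowSum_dotProduct {d m : ℕ} (W : Matrix (Fin m) (Fin d) ℝ) (S : Finset (Fin m))
    (x : Fin d → ℝ) : rowSum W S ⬝ᵥ x = ∑ i ∈ S, W i ⬝ᵥ x :=
  sum_dotProduct _ _ _

/-- The network `x ↦ ∑ i, max 0 (W i ⬝ᵥ x) - 1`. -/
noncomputable def conicalNetwork {d m : ℕ} (W : Matrix (Fin m) (Fin d) ℝ) : (Fin d → ℝ) → ℝ :=
  fun x => ∑ i, max 0 (W i ⬝ᵥ x) - 1

theorem conicalNetwork_mem_SHL {d m : ℕ} (W : Matrix (Fin m) (Fin d) ℝ) :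
    conicalNetwork W ∈ SHL d m := by
  refine ⟨1, W, 0, -1, funext fun x => ?_⟩
  rw [one_dotProduct, add_zero, ← sub_eq_add_neg]
  rfl

theorem conicalNetwork_eq {d m : ℕ} {W : Matrix (Fin m) (Fin d) ℝ} {S : Finset (Fin m)}
    {x : Fin d → ℝ} (hx : ∀ i, (i ∈ S → 0 ≤ W i ⬝ᵥ x) ∧ (i ∉ S → W i ⬝ᵥ x ≤ 0)) :
    conicalNetwork W x = rowSum W S ⬝ᵥ x - 1 := by
  rw [conicalNetwork, sum_max_eq_sum_of_nonneg_of_nonpos hx, rowSum_dotProduct]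

theorem IsStrictPattern.exists_sum_dotProduct_eq_one {d m : ℕ} {W : Matrix (Fin m) (Fin d) ℝ}
    {S : Finset (Fin m)} (h : IsStrictPattern W S) (hS : S.Nonempty) :
    ∃ x : Fin d → ℝ, (∀ i, (i ∈ S → 0 < W i ⬝ᵥ x) ∧ (i ∉ S → W i ⬝ᵥ x < 0)) ∧
      rowSum W S ⬝ᵥ x = 1 := by
  obtain ⟨x, hx⟩ := h
  have hpos : 0 < rowSum W S ⬝ᵥ x := by
    rw [rowSum_dotProduct]
    exact sum_pos (fun i hi => (hx i).1 hi) hS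
  refine ⟨(rowSum W S ⬝ᵥ x)⁻¹ • x, fun i => ?_, ?_⟩
  · simp only [dotProduct_smul, smul_eq_mul]
    exact ⟨fun hi => mul_pos (inv_pos.2 hpos) ((hx i).1 hi),
      fun hi => mul_neg_of_pos_of_neg (inv_pos.2 hpos) ((hx i).2 hi)⟩
  · rw [dotProduct_smul, smul_eq_mul, inv_mul_cancel₀ hpos.ne']

/-- A small step along `v` makes the vanishing rows positive and keeps the negative ones negative.
-/
theorem isStrictPattern_nonneg {d m : ℕ} {W : Matrix (Fin m) (Fin d) ℝ} {v : Fin d → ℝ}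
    (hv : ∀ i, 0 < W i ⬝ᵥ v) (x : Fin d → ℝ) :
    IsStrictPattern W {i | 0 ≤ W i ⬝ᵥ x} := by
  have hev : ∀ i, ∀ᶠ t in nhds (0 : ℝ), W i ⬝ᵥ x < 0 → W i ⬝ᵥ x + t * (W i ⬝ᵥ v) < 0 := by
    intro i
    by_cases hi : W i ⬝ᵥ x < 0
    · have hc : Continuous fun t : ℝ => W i ⬝ᵥ x + t * (W i ⬝ᵥ v) := by fun_prop
      filter_upwards [(hc.tendsto 0).eventually_lt_const (by simpa using hi)] with t ht _
      exact ht
    · exact Filter.Eventually.of_forall fun t h => absurd h hi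
  obtain ⟨t, ht, ht0⟩ := (((Filter.eventually_all.2 hev).filter_mono nhdsWithin_le_nhds).and
    (self_mem_nhdsWithin : Set.Ioi (0 : ℝ) ∈ nhdsWithin 0 (Set.Ioi 0))).exists
  refine ⟨x + t • v, fun i => ?_⟩
  simp only [mem_filter, mem_univ, true_and, dotProduct_add, dotProduct_smul, smul_eq_mul, not_le]
  exact ⟨fun h => add_pos_of_nonneg_of_pos h (mul_pos ht0 (hv i)), ht i⟩

/-- Every nonempty strict pattern contributes a facet to the boundary of `conicalNetwork W`. -/
theorem hasFullDimFacets_conicalNetwork {d m : ℕ} {W : Matrix (Fin m) (Fin d) ℝ}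
    {v : Fin d → ℝ} (hv : ∀ i, 0 < W i ⬝ᵥ v) {P : Finset (Finset (Fin m))}
    (hP : ∀ S, S ∈ P ↔ IsStrictPattern W S ∧ S.Nonempty) :
    HasFullDimFacets (conicalNetwork W) #P := by
  let e := P.equivFin.symm
  have hpt : ∀ k, ∃ x : Fin d → ℝ,
      (∀ i, (i ∈ (e k : Finset (Fin m)) → 0 < W i ⬝ᵥ x) ∧
        (i ∉ (e k : Finset (Fin m)) → W i ⬝ᵥ x < 0)) ∧
      rowSum W (e k) ⬝ᵥ x = 1 := fun k =>
    ((hP _).1 (e k).2).1.exists_sum_dotProduct_eq_one ((hP _).1 (e k).2).2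
  -- The point `p k` lies on the `k`-th hyperplane only, which gives both distinctness and
  -- irredundancy.
  choose p hp hp1 using hpt
  have hzero : ∀ k, conicalNetwork W (p k) = 0 := fun k => by
    rw [conicalNetwork_eq fun i => ⟨fun h => ((hp k i).1 h).le, fun h => ((hp k i).2 h).le⟩,
      hp1, sub_self]
  have hlt : ∀ k l, l ≠ k → rowSum W (e l) ⬝ᵥ p k < 1 := by
    intro k l hlk
    rw [← hp1 k, rowSum_dotProduct, rowSum_dotProduct]
    exact sum_lt_sum_of_pos_of_neg (hp k) fun h => hlk (e.injective (Subtype.ext h))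
  have honly : ∀ k l, p k ∈ boundarySection (conicalNetwork W) (rowSum W (e l)) (-1) → l = k := by
    intro k l h
    by_contra hne
    have h₁ := hlt k l hne
    have h₂ := h.1
    linarith
  have hmem : ∀ k, p k ∈ boundarySection (conicalNetwork W) (rowSum W (e k)) (-1) :=
    fun k => ⟨by rw [hp1]; norm_num, hzero k⟩
  refine ⟨fun k => rowSum W (e k), fun _ => -1, ⟨?_, ?_, ?_, ?_⟩, ?_⟩
  · intro k h
    have := hp1 k
    rw [h, zero_dotProduct] at this
    exact zero_ne_one this
  · intro k l hkl
    have h := hmem l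
    rw [← show boundarySection _ _ _ = boundarySection _ _ _ from hkl] at h
    exact honly l k h
  · refine Set.Subset.antisymm (fun x hx => ?_) (Set.iUnion_subset fun k x hx => hx.2)
    set S : Finset (Fin m) := {i | 0 ≤ W i ⬝ᵥ x} with hS
    have hSx := conicalNetwork_eq (W := W) (S := S) (x := x)
      fun i => ⟨fun h => by simpa [hS] using h, fun h => le_of_not_ge (by simpa [hS] using h)⟩
    have hx0 : conicalNetwork W x = 0 := hx
    rw [hx0] at hSx
    have hSP : S ∈ P := by
      refine (hP S).2 ⟨isStrictPattern_nonneg hv x, nonempty_iff_ne_empty.2 fun h => ?_⟩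
      simp [h, rowSum_dotProduct] at hSx
    refine Set.mem_iUnion.2 ⟨e.symm ⟨S, hSP⟩, ?_, hx⟩
    rw [Equiv.apply_symm_apply]
    linarith
  · intro k h
    have hk : p k ∈ boundary (conicalNetwork W) := hzero k
    rw [← h] at hk
    obtain ⟨l, hl, hkl⟩ := Set.mem_iUnion₂.1 hk
    exact hl (honly k l hkl)
  · intro k
    refine ⟨p k, (hmem k).1, ?_⟩
    have hev : ∀ i, ∀ᶠ y in nhds (p k), (i ∈ (e k : Finset (Fin m)) → 0 ≤ W i ⬝ᵥ y) ∧
        (i ∉ (e k : Finset (Fin m)) → W i ⬝ᵥ y ≤ 0) := by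
      intro i
      have hc : Continuous fun y : Fin d → ℝ => W i ⬝ᵥ y := continuous_const.dotProduct continuous_id
      by_cases hi : i ∈ (e k : Finset (Fin m))
      · filter_upwards [(hc.tendsto _).eventually_const_lt ((hp k i).1 hi)] with y hy
        exact ⟨fun _ => hy.le, fun h => absurd hi h⟩
      · filter_upwards [(hc.tendsto _).eventually_lt_const ((hp k i).2 hi)] with y hy
        exact ⟨fun h => absurd h hi, fun _ => hy.le⟩
    filter_upwards [Filter.eventually_all.2 hev] with y hy h
    rw [conicalNetwork_eq hy]
    linarith

/-! ### Sign patterns on the moment curve -/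

/-- The matrix whose rows are the points of the moment curve with parameters `0, …, m - 1`. -/
def momentMatrix (d m : ℕ) : Matrix (Fin m) (Fin d) ℝ := fun i j => (i : ℝ) ^ (j : ℕ)

theorem momentMatrix_dotProduct_coeff {d m : ℕ} {p : Polynomial ℝ} (hp : p.natDegree < d)
    (i : Fin m) : momentMatrix d m i ⬝ᵥ (fun j => p.coeff j) = p.eval (i : ℝ) := by
  rw [Polynomial.eval_eq_sum_range' hp, dotProduct,
    ← Fin.sum_univ_eq_sum_range fun j => p.coeff j * (i : ℝ) ^ j]
  exact sum_congr rfl fun j _ => mul_comm _ _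

/-- The product `∏ j ∈ J, (t - (j + 1 / 2))`, which changes sign between `j` and `j + 1` for the
`j ∈ J` only. -/
noncomputable def gapPolynomial (J : Finset ℕ) : Polynomial ℝ :=
  ∏ j ∈ J, (Polynomial.X - Polynomial.C ((j : ℝ) + 1 / 2))

theorem natDegree_gapPolynomial (J : Finset ℕ) : (gapPolynomial J).natDegree = #J :=
  Polynomial.natDegree_finsetProd_X_sub_C_eq_card J _

theorem eval_gapPolynomial (J : Finset ℕ) (t : ℝ) :
    (gapPolynomial J).eval t = ∏ j ∈ J, (t - ((j : ℝ) + 1 / 2)) := by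
  simp [gapPolynomial, Polynomial.eval_prod]

theorem eval_gapPolynomial_ne_zero (J : Finset ℕ) (i : ℕ) :
    (gapPolynomial J).eval (i : ℝ) ≠ 0 := by
  rw [eval_gapPolynomial]
  refine prod_ne_zero_iff.2 fun j _ h => ?_
  have : (2 * i : ℝ) = 2 * j + 1 := by linarith
  norm_cast at this
  omega

/-- Only the factor with root `i + 1 / 2` changes sign between `i` and `i + 1`. -/
theorem eval_gapPolynomial_mul_succ_neg_iff (J : Finset ℕ) (i : ℕ) :
    (gapPolynomial J).eval (i : ℝ) * (gapPolynomial J).eval ((i + 1 : ℕ) : ℝ) < 0 ↔ i ∈ J := by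
  have hfac : ∀ j, j ≠ i →
      0 < ((i : ℝ) - ((j : ℝ) + 1 / 2)) * (((i + 1 : ℕ) : ℝ) - ((j : ℝ) + 1 / 2)) := by
    intro j hj
    push_cast
    rcases lt_or_gt_of_ne hj with h | h
    · have : (j : ℝ) + 1 ≤ i := by exact_mod_cast h
      exact mul_pos (by linarith) (by linarith)
    · have : (i : ℝ) + 1 ≤ j := by exact_mod_cast h
      exact mul_pos_of_neg_of_neg (by linarith) (by linarith)
  rw [eval_gapPolynomial, eval_gapPolynomial, ← prod_mul_distrib]
  constructor
  · intro h
    by_contra hi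
    exact h.not_gt (prod_pos fun j hj => hfac j fun hji => hi (hji ▸ hj))
  · intro hi
    rw [← mul_prod_erase J _ hi]
    refine mul_neg_of_neg_of_pos ?_ (prod_pos fun j hj => hfac j (ne_of_mem_erase hj))
    push_cast
    nlinarith

theorem card_biUnion_powersetCard (d n : ℕ) :
    #((range d).biUnion fun k => powersetCard k (range n)) = ∑ k ∈ range d, n.choose k := by
  rw [card_biUnion]
  · simp
  · intro k _ l _ hkl
    exact pairwise_disjoint_powersetCard (range n) hkl

/-- The indices at which `gapPolynomial J`, or its negative, is positive. -/
noncomputable def gapPattern (m : ℕ) (q : Bool × Finset ℕ) : Finset (Fin m) :=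
  {i | 0 < (if q.1 then (1 : ℝ) else -1) * (gapPolynomial q.2).eval (i : ℝ)}

theorem isStrictPattern_gapPattern {d m : ℕ} {q : Bool × Finset ℕ} (hq : #q.2 < d) :
    IsStrictPattern (momentMatrix d m) (gapPattern m q) := by
  let s : ℝ := if q.1 then 1 else -1
  have hs : s ≠ 0 := by
    simp only [s]
    split_ifs <;> norm_num
  have hdeg : (Polynomial.C s * gapPolynomial q.2).natDegree < d :=
    (Polynomial.natDegree_C_mul_le _ _).trans_lt ((natDegree_gapPolynomial _).trans_lt hq)
  refine ⟨fun j => (Polynomial.C s * gapPolynomial q.2).coeff j, fun i => ?_⟩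
  rw [momentMatrix_dotProduct_coeff hdeg, Polynomial.eval_mul, Polynomial.eval_C]
  have hne := mul_ne_zero hs (eval_gapPolynomial_ne_zero q.2 i)
  refine ⟨fun h => (mem_filter.1 h).2, fun h => lt_of_le_of_ne (not_lt.1 fun h' => h ?_) hne⟩
  exact mem_filter.2 ⟨mem_univ i, h'⟩

/-- The sign changes between consecutive indices recover the gap set, and the sign at index 0 then
recovers the Boolean. -/
theorem gapPattern_injOn {m : ℕ} (hm : 1 ≤ m) :
    Set.InjOn (gapPattern m) {q | q.2 ⊆ range (m - 1)} := by
  rintro ⟨ε, J⟩ hJ ⟨δ, K⟩ hK h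
  simp only [Set.mem_ofPred_eq] at hJ hK
  let s : Bool → ℝ := fun ε => if ε then 1 else -1
  have hss : ∀ ε, s ε * s ε = 1 := by intro ε; cases ε <;> simp [s]
  have hsign : ∀ i < m, 0 < s ε * (gapPolynomial J).eval (i : ℝ) ↔
      0 < s δ * (gapPolynomial K).eval (i : ℝ) := by
    intro i hi
    simpa [gapPattern, s] using Finset.ext_iff.1 h ⟨i, hi⟩
  have hmul : ∀ (ε : Bool) (J : Finset ℕ) (i : ℕ),
      i ∈ J ↔ ¬ (0 < s ε * (gapPolynomial J).eval (i : ℝ) ↔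
        0 < s ε * (gapPolynomial J).eval ((i + 1 : ℕ) : ℝ)) := by
    intro ε J i
    have hs : s ε ≠ 0 := fun h0 => by simpa [h0] using hss ε
    have h₁ := mul_ne_zero hs (eval_gapPolynomial_ne_zero J i)
    have h₂ := mul_ne_zero hs (eval_gapPolynomial_ne_zero J (i + 1))
    rw [← eval_gapPolynomial_mul_succ_neg_iff,
      show (gapPolynomial J).eval (i : ℝ) * (gapPolynomial J).eval ((i + 1 : ℕ) : ℝ) =
        (s ε * (gapPolynomial J).eval (i : ℝ)) *
          (s ε * (gapPolynomial J).eval ((i + 1 : ℕ) : ℝ)) by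
        rw [mul_mul_mul_comm, hss, one_mul], mul_neg_iff]
    generalize s ε * (gapPolynomial J).eval (i : ℝ) = u at *
    generalize s ε * (gapPolynomial J).eval ((i + 1 : ℕ) : ℝ) = w at *
    rcases lt_or_gt_of_ne h₁ with h₁ | h₁ <;> rcases lt_or_gt_of_ne h₂ with h₂ | h₂ <;>
      simp [h₁, h₂, h₁.not_gt, h₂.not_gt]
  have hJK : J = K := by
    ext i
    by_cases hi : i < m - 1
    · rw [hmul ε J, hmul δ K, hsign i (by omega), hsign (i + 1) (by omega)]
    · exact iff_of_false (fun h' => hi (mem_range.1 (hJ h'))) fun h' => hi (mem_range.1 (hK h'))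
  subst hJK
  refine Prod.ext ?_ rfl
  have h0 := hsign 0 hm
  have hne := eval_gapPolynomial_ne_zero J 0
  generalize (gapPolynomial J).eval ((0 : ℕ) : ℝ) = u at *
  rcases lt_or_gt_of_ne hne with hu | hu <;> cases ε <;> cases δ <;>
    simp [s, hu, hu.not_gt] at h0 ⊢

theorem exists_hasFullDimFacets {d m : ℕ} (hm : 1 ≤ m) :
    ∃ n, (∃ f ∈ SHL d m, HasFullDimFacets f n) ∧ unboundedRegionCount d m ≤ n + 1 := by
  classical
  rcases Nat.eq_zero_or_pos d with rfl | hd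
  · refine ⟨0, ⟨fun _ => 1, ⟨0, 0, 0, 1, by simp⟩, Fin.elim0, Fin.elim0, ⟨?_, ?_, ?_, ?_⟩, ?_⟩, ?_⟩
    · exact fun k => k.elim0
    · exact fun k => k.elim0
    · simp [boundary]
    · exact fun k => k.elim0
    · exact fun k => k.elim0
    · simp [unboundedRegionCount]
  let P : Finset (Finset (Fin m)) := {S | IsStrictPattern (momentMatrix d m) S ∧ S.Nonempty}
  -- The zeroth column consists of ones, since `0 ^ 0 = 1`.
  have hv : ∀ i : Fin m, 0 < momentMatrix d m i ⬝ᵥ Pi.single ⟨0, hd⟩ 1 := by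
    intro i
    simp [momentMatrix]
  refine ⟨#P, ⟨conicalNetwork (momentMatrix d m), conicalNetwork_mem_SHL _,
    hasFullDimFacets_conicalNetwork hv fun S => by simp [P]⟩, ?_⟩
  let Q : Finset (Bool × Finset ℕ) :=
    univ ×ˢ (range d).biUnion fun k => powersetCard k (range (m - 1))
  have hQ : ∀ q ∈ Q, #q.2 < d ∧ q.2 ⊆ range (m - 1) := by
    intro q hq
    simp only [Q, mem_product, mem_univ, true_and, mem_biUnion, mem_powersetCard, mem_range] at hq
    obtain ⟨k, hk, hsub, rfl⟩ := hq
    exact ⟨hk, hsub⟩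
  calc unboundedRegionCount d m = #Q := by
        rw [card_product, card_biUnion_powersetCard, unboundedRegionCount, card_univ,
          Fintype.card_bool]
    _ = #(Q.image (gapPattern m)) :=
        (card_image_of_injOn ((gapPattern_injOn hm).mono fun q hq => (hQ q hq).2)).symm
    -- The empty pattern yields no facet, whence the `- 1` in the lower bound.
    _ ≤ #(insert ∅ P) := by
        refine card_le_card fun S hS => ?_
        obtain ⟨q, hq, rfl⟩ := mem_image.1 hS
        rcases (gapPattern m q).eq_empty_or_nonempty with h | h
        · rw [h]
          exact mem_insert_self _ _
        · exact mem_insert_of_mem (mem_filter.2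
            ⟨mem_univ _, isStrictPattern_gapPattern (hQ q hq).1, h⟩)
    _ ≤ #P + 1 := card_insert_le _ _

theorem HasFullDimFacets.hasFacets {d n : ℕ} {f : (Fin d → ℝ) → ℝ} (h : HasFullDimFacets f n) :
    HasFacets f n :=
  let ⟨a, b, hab, _⟩ := h
  ⟨a, b, hab⟩

theorem exists_isGreatest_of_le {A : Set ℕ} {l u : ℕ} (hA : ∃ n ∈ A, l ≤ n + 1)
    (hu : ∀ n ∈ A, n ≤ u) :
    ∃ N : ℕ, IsGreatest A N ∧ (l : ℤ) - 1 ≤ (N : ℤ) ∧ N ≤ u := by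
  obtain ⟨n, hn, hln⟩ := hA
  have hb : BddAbove A := ⟨u, hu⟩
  have hmem := Nat.sSup_mem ⟨n, hn⟩ hb
  have hle := le_csSup hb hn
  exact ⟨sSup A, ⟨hmem, fun k hk => le_csSup hb hk⟩, by omega, hu _ hmem⟩

theorem theorem5 (d m : ℕ) (hm : 1 ≤ m) :
    (∃ N : ℕ, IsGreatest {n : ℕ | ∃ f ∈ SHL d m, HasFacets f n} N ∧
      (unboundedRegionCount d m : ℤ) - 1 ≤ (N : ℤ) ∧ N ≤ regionCount d m) ∧
    (∃ N : ℕ, IsGreatest {n : ℕ | ∃ f ∈ SHL d m, HasFullDimFacets f n} N ∧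
      (unboundedRegionCount d m : ℤ) - 1 ≤ (N : ℤ) ∧ N ≤ regionCount d m) := by
  obtain ⟨n, ⟨f, hf, hn⟩, hle⟩ := exists_hasFullDimFacets (d := d) hm
  refine ⟨exists_isGreatest_of_le ⟨n, ⟨f, hf, hn.hasFacets⟩, hle⟩ ?_,
    exists_isGreatest_of_le ⟨n, ⟨f, hf, hn⟩, hle⟩ ?_⟩
  · rintro k ⟨g, hg, hk⟩
    exact hk.le_regionCount hg
  · rintro k ⟨g, hg, hk⟩
    exact hk.hasFacets.le_regionCount hg
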